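/- Let $(B,g_B)$ be a smooth finite-dimensional Riemannian manifold without boundary (not assumed connected, compact or complete) of bounded nonpositive sectional curvature, i.e. there is a constant $C$ such that $C\le K_{g_B}(\sigma)\le 0$ for every $2$-plane $\sigma$ tangent to $B$. Then there is a $C^\infty$ function $h:\mathbb R\to\mathbb R$ that is positive, (strictly) increasing and convex, with $h(r)=e^r$ for all sufficiently large $r$, such that the warped product metric $g=dr^2+h(r)^2g_B$ on $\mathbb R\times B$ has negative sectional curvature that is bounded below: there is a constant $c$ such that $c\le K_g(\sigma)<0$ for every $2$-plane $\sigma$ tangent to $\mathbb R\times B$. -/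

import Mathlib

open scoped Manifold ContDiff Bundle

noncomputable section

namespace RiemannianGeometry

section Coordinates

variable {E : Type*} [NormedAddCommGroup E] [NormedSpace ℝ E]

/-- A Riemannian metric in local coordinates: `G y u v` is the inner product at the point with
coordinates `y` of the tangent vectors with coordinate vectors `u` and `v`.

`christoffel G y u v` is the vector `Γ_y(u, v)` of Christoffel symbols of the second kind,
i.e. the solution of
`2 G_y(Γ_y(u, v), w) = (D_u G)_y(v, w) + (D_v G)_y(u, w) - (D_w G)_y(u, v)` for all `w`.
In other words, `∇_u v = Γ(u, v)` for the constant vector fields `u`, `v` and the Levi-Civita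
connection `∇` of `G`. -/
def christoffel (G : E → E →L[ℝ] E →L[ℝ] ℝ) (y u v : E) : E :=
  (G y).inverse ((1 / 2 : ℝ) •
    (fderiv ℝ G y u v + fderiv ℝ G y v u - ((fderiv ℝ G y).flip u).flip v))

/-- The Riemann curvature tensor `R(u, v) w = ∇_u ∇_v w - ∇_v ∇_u w - ∇_[u, v] w` of the metric `G`
at the point with coordinates `y`, computed with the constant vector fields `u`, `v`, `w`. -/
def coordCurvature (G : E → E →L[ℝ] E →L[ℝ] ℝ) (y u v w : E) : E :=
  (fderiv ℝ (fun z => christoffel G z v w) y u + christoffel G y u (christoffel G y v w))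
    - (fderiv ℝ (fun z => christoffel G z u w) y v + christoffel G y v (christoffel G y u w))

end Coordinates

section Manifold

variable {E : Type*} [NormedAddCommGroup E] [NormedSpace ℝ E]
  {H : Type*} [TopologicalSpace H] {I : ModelWithCorners ℝ E H}
  {M : Type*} [TopologicalSpace M] [ChartedSpace H M] [IsManifold I ∞ M]

/-- The expression of the Riemannian metric `g` in the preferred chart `φ` at `x`, i.e. the
pullback of `g` under `φ⁻¹` (for manifolds without boundary). -/
def chartMetric (g : Bundle.ContMDiffRiemannianMetric I ∞ E (fun x : M => TangentSpace I x))
    (x : M) (y : E) : E →L[ℝ] E →L[ℝ] ℝ :=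
  ContinuousLinearMap.bilinearComp (E := E) (F := E) (g.inner ((extChartAt I x).symm y))
    (mfderiv 𝓘(ℝ, E) I (extChartAt I x).symm y) (mfderiv 𝓘(ℝ, E) I (extChartAt I x).symm y)

/-- The sectional curvature `⟨R(u, v) v, u⟩ / (⟨u, u⟩ ⟨v, v⟩ - ⟨u, v⟩²)` of `g` at `x`, along the
plane spanned by the linearly independent tangent vectors `u`, `v` (for manifolds without
boundary); the curvature tensor is computed in the preferred chart at `x`. -/
def sectionalCurvature (g : Bundle.ContMDiffRiemannianMetric I ∞ E (fun x : M => TangentSpace I x))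
    (x : M) (u v : TangentSpace I x) : ℝ :=
  let y : E := extChartAt I x x
  let u' : E := mfderiv I 𝓘(ℝ, E) (extChartAt I x) x u
  let v' : E := mfderiv I 𝓘(ℝ, E) (extChartAt I x) x v
  chartMetric g x y (coordCurvature (chartMetric g x) y u' v' v') u' /
    (g.inner x u u * g.inner x v v - g.inner x u v ^ 2)

/-- The sectional curvature of `g` along every tangent plane is at least `c`. -/
def SecBoundedBelowBy
    (g : Bundle.ContMDiffRiemannianMetric I ∞ E (fun x : M => TangentSpace I x)) (c : ℝ) : Prop :=
  ∀ (x : M) (u v : TangentSpace I x), LinearIndependent ℝ ![u, v] → c ≤ sectionalCurvature g x u v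

/-- The sectional curvature of `g` along every tangent plane is nonpositive. -/
def SecNonpos
    (g : Bundle.ContMDiffRiemannianMetric I ∞ E (fun x : M => TangentSpace I x)) : Prop :=
  ∀ (x : M) (u v : TangentSpace I x), LinearIndependent ℝ ![u, v] → sectionalCurvature g x u v ≤ 0

/-- The sectional curvature of `g` along every tangent plane is negative. -/
def SecNeg (g : Bundle.ContMDiffRiemannianMetric I ∞ E (fun x : M => TangentSpace I x)) : Prop :=
  ∀ (x : M) (u v : TangentSpace I x), LinearIndependent ℝ ![u, v] → sectionalCurvature g x u v < 0

end Manifold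

section Warped

variable {E : Type*} [NormedAddCommGroup E] [NormedSpace ℝ E]
  {H : Type*} [TopologicalSpace H] {I : ModelWithCorners ℝ E H}
  {B : Type*} [TopologicalSpace B] [ChartedSpace H B] [IsManifold I ∞ B]

/-- The inner product `⟨(a, u), (b, v)⟩ = a b + h(r)² g_B(u, v)` on
`T_(r, x) (ℝ × B) = ℝ × T_x B`. -/
def warpedInner (gB : Bundle.ContMDiffRiemannianMetric I ∞ E (fun x : B => TangentSpace I x))
    (h : ℝ → ℝ) (p : ℝ × B) :
    TangentSpace (𝓘(ℝ, ℝ).prod I) p →L[ℝ] TangentSpace (𝓘(ℝ, ℝ).prod I) p →L[ℝ] ℝ :=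
  (ContinuousLinearMap.mul ℝ ℝ).bilinearComp
      (ContinuousLinearMap.fst ℝ ℝ E) (ContinuousLinearMap.fst ℝ ℝ E)
    + h p.1 ^ 2 • ContinuousLinearMap.bilinearComp (E := E) (F := E) (gB.inner p.2)
      (ContinuousLinearMap.snd ℝ ℝ E) (ContinuousLinearMap.snd ℝ ℝ E)

theorem warpedInner_apply
    (gB : Bundle.ContMDiffRiemannianMetric I ∞ E (fun x : B => TangentSpace I x))
    (h : ℝ → ℝ) (p : ℝ × B) (v w : TangentSpace (𝓘(ℝ, ℝ).prod I) p) :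
    warpedInner gB h p v w = v.1 * w.1 + h p.1 ^ 2 * gB.inner p.2 v.2 w.2 := rfl

theorem hasFDerivWithinAt_prodMap_aux {E₁ E₂ : Type*} [NormedAddCommGroup E₁] [NormedSpace ℝ E₁]
    [NormedAddCommGroup E₂] [NormedSpace ℝ E₂] {f : E₁ → E₁} {g : E₂ → E₂} {f' : E₁ →L[ℝ] E₁}
    {g' : E₂ →L[ℝ] E₂} {s : Set E₁} {t : Set E₂} {x : E₁} {y : E₂}
    (hf : HasFDerivWithinAt f f' s x) (hg : HasFDerivWithinAt g g' t y) :
    HasFDerivWithinAt (fun p : E₁ × E₂ => (f p.1, g p.2)) (f'.prodMap g') (s ×ˢ t) (x, y) :=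
  HasFDerivWithinAt.prodMap (x, y) (hf.mono (Set.fst_image_prod_subset s t))
    (hg.mono (Set.snd_image_prod_subset s t))

theorem coordChange_prod (p q z : ℝ × B) (hz : z.2 ∈ (chartAt H p.2).source)
    (hz' : z.2 ∈ (chartAt H q.2).source) :
    tangentCoordChange (𝓘(ℝ, ℝ).prod I) p q z =
      ContinuousLinearMap.prodMap (1 : ℝ →L[ℝ] ℝ) (tangentCoordChange I p.2 q.2 z.2) := by
  have h2 := hasFDerivWithinAt_tangentCoordChange (I := I) (x := p.2) (y := q.2) (z := z.2)
    ⟨by simpa using hz, by simpa using hz'⟩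
  have h1 : HasFDerivWithinAt (extChartAt 𝓘(ℝ, ℝ) q.1 ∘ (extChartAt 𝓘(ℝ, ℝ) p.1).symm)
      (1 : ℝ →L[ℝ] ℝ) (Set.range 𝓘(ℝ, ℝ)) (extChartAt 𝓘(ℝ, ℝ) p.1 z.1) := by
    simpa using! hasFDerivWithinAt_id z.1 Set.univ
  have h := hasFDerivWithinAt_tangentCoordChange (I := 𝓘(ℝ, ℝ).prod I) (x := p) (y := q) (z := z)
    ⟨by simpa [chartAt_self_eq] using hz, by simpa [chartAt_self_eq] using hz'⟩
  have hu : UniqueDiffWithinAt ℝ (Set.range (𝓘(ℝ, ℝ).prod I)) (extChartAt (𝓘(ℝ, ℝ).prod I) p z) :=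
    (𝓘(ℝ, ℝ).prod I).uniqueDiffWithinAt_image
  apply hu.eq h
  rw [ModelWithCorners.range_prod, extChartAt_prod, extChartAt_prod]
  exact hasFDerivWithinAt_prodMap_aux h1 h2

theorem symm_trivializationAt_prod (p z : ℝ × B) (hz : z.2 ∈ (chartAt H p.2).source) (v : ℝ × E) :
    (trivializationAt (ℝ × E) (TangentSpace (𝓘(ℝ, ℝ).prod I)) p).symm z v =
      (v.1, (trivializationAt E (TangentSpace I) p.2).symm z.2 v.2) := by
  have hz' : z ∈ (chartAt (ModelProd ℝ H) p).source := by simpa [chartAt_self_eq] using hz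
  have e1 := congrArg (fun f => f v)
    (TangentBundle.symmL_trivializationAt_eq_core (𝕜 := ℝ) (I := 𝓘(ℝ, ℝ).prod I) hz')
  have e2 := congrArg (fun f => f v.2)
    (TangentBundle.symmL_trivializationAt_eq_core (𝕜 := ℝ) (I := I) hz)
  have e3 := congrArg (fun f => f v) (coordChange_prod (I := I) p z z hz (by simp))
  refine (Bundle.Trivialization.symmL_apply _ hz' v).symm.trans <| e1.trans (e3.trans ?_)
  exact congrArg (fun t : E => ((v.1, t) : ℝ × E))
    (e2.symm.trans (Bundle.Trivialization.symmL_apply _ hz v.2))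

theorem inner_zero_zero
    (gB : Bundle.ContMDiffRiemannianMetric I ∞ E (fun x : B => TangentSpace I x)) (b : B) :
    gB.inner b 0 0 = 0 := by
  rw [map_zero]

theorem inner_smul_smul
    (gB : Bundle.ContMDiffRiemannianMetric I ∞ E (fun x : B => TangentSpace I x)) (b : B)
    (c : ℝ) (v : TangentSpace I b) :
    gB.inner b (c • v) (c • v) = c ^ 2 * gB.inner b v v := by
  rw [map_smul, map_smul, smul_apply, smul_eq_mul, smul_eq_mul]
  ring

theorem warpedInner_pos
    (gB : Bundle.ContMDiffRiemannianMetric I ∞ E (fun x : B => TangentSpace I x))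
    (h : ℝ → ℝ) {p : ℝ × B} (hpos : 0 < h p.1) (v : TangentSpace (𝓘(ℝ, ℝ).prod I) p)
    (hv : v ≠ 0) : 0 < warpedInner gB h p v v := by
  have hh : 0 < h p.1 ^ 2 := by positivity
  rw [warpedInner_apply]
  by_cases h2 : (v.2 : TangentSpace I p.2) = 0
  · have h1 : v.1 ≠ 0 := fun h1 => hv (Prod.ext h1 h2)
    have h3 : gB.inner p.2 v.2 v.2 = 0 := by
      exact (congrArg (fun t : TangentSpace I p.2 => gB.inner p.2 t t) h2).trans
        (inner_zero_zero gB p.2)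
    rw [h3, mul_zero, add_zero]
    exact mul_self_pos.2 h1
  · have h3 := gB.pos p.2 v.2 h2
    have h4 := mul_self_nonneg v.1
    positivity

theorem isVonNBounded_warpedInner
    (gB : Bundle.ContMDiffRiemannianMetric I ∞ E (fun x : B => TangentSpace I x))
    (h : ℝ → ℝ) {p : ℝ × B} (hpos : 0 < h p.1) :
    Bornology.IsVonNBounded ℝ
      {v : TangentSpace (𝓘(ℝ, ℝ).prod I) p | warpedInner gB h p v v < 1} := by
  have hb : Bornology.IsBounded {v : E | gB.inner p.2 v v < 1} :=
    (NormedSpace.isVonNBounded_iff ℝ (E := E)).1 (gB.isVonNBounded p.2)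
  obtain ⟨C, hC⟩ := hb.exists_norm_le
  refine (NormedSpace.isVonNBounded_iff ℝ (E := ℝ × E)).2 ?_
  refine isBounded_iff_forall_norm_le.2 ⟨max 1 ((h p.1)⁻¹ * C), fun v hv => ?_⟩
  have hv' : v.1 * v.1 + h p.1 ^ 2 * gB.inner p.2 v.2 v.2 < 1 := hv
  have hn : 0 ≤ gB.inner p.2 v.2 v.2 := by
    by_cases h2 : (v.2 : TangentSpace I p.2) = 0
    · exact ((congrArg (fun t : TangentSpace I p.2 => gB.inner p.2 t t) h2).trans
        (inner_zero_zero gB p.2)).ge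
    · exact (gB.pos p.2 v.2 h2).le
  have hm : 0 ≤ h p.1 ^ 2 * gB.inner p.2 v.2 v.2 := by positivity
  rw [Prod.norm_def]
  refine max_le_max ?_ ?_
  · rw [Real.norm_eq_abs, abs_le]
    constructor <;> nlinarith
  · have h1 := inner_smul_smul gB p.2 (h p.1) v.2
    have h2 : ‖h p.1 • v.2‖ ≤ C := by
      refine hC _ (h1.trans_lt ?_)
      nlinarith [mul_self_nonneg v.1]
    rw [norm_smul, Real.norm_of_nonneg hpos.le] at h2
    rw [← div_eq_inv_mul, le_div_iff₀ hpos]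
    linarith

theorem contMDiff_warpedInner
    (gB : Bundle.ContMDiffRiemannianMetric I ∞ E (fun x : B => TangentSpace I x))
    {h : ℝ → ℝ} (hh : ContDiff ℝ ∞ h) :
    ContMDiff (𝓘(ℝ, ℝ).prod I)
      ((𝓘(ℝ, ℝ).prod I).prod 𝓘(ℝ, (ℝ × E) →L[ℝ] (ℝ × E) →L[ℝ] ℝ)) ∞
      (fun p : ℝ × B => Bundle.TotalSpace.mk' ((ℝ × E) →L[ℝ] (ℝ × E) →L[ℝ] ℝ) p
        (warpedInner gB h p)) := by
  intro p₀
  rw [contMDiffAt_hom_bundle]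
  refine ⟨contMDiffAt_id, ?_⟩
  have hB := (contMDiffAt_hom_bundle _).1 (gB.contMDiff p₀.2)
  have hB2 := hB.2.comp p₀ (contMDiffAt_snd (I := 𝓘(ℝ, ℝ)) (J := I))
  have hr : ContMDiffAt (𝓘(ℝ, ℝ).prod I) 𝓘(ℝ, ℝ) ∞ (fun p : ℝ × B => h p.1 ^ 2) p₀ :=
    ((hh.pow 2).contMDiff p₀.1).comp p₀ (contMDiffAt_fst (I := 𝓘(ℝ, ℝ)) (J := I))
  let P : (E →L[ℝ] ℝ) →L[ℝ] ((ℝ × E) →L[ℝ] ℝ) :=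
    (ContinuousLinearMap.compL ℝ (ℝ × E) E ℝ).flip (ContinuousLinearMap.snd ℝ ℝ E)
  have hL : ContMDiffAt (𝓘(ℝ, ℝ).prod I) 𝓘(ℝ, (ℝ × E) →L[ℝ] (ℝ × E) →L[ℝ] ℝ) ∞
      (fun p : ℝ × B => (ContinuousLinearMap.mul ℝ ℝ).bilinearComp
        (ContinuousLinearMap.fst ℝ ℝ E) (ContinuousLinearMap.fst ℝ ℝ E) + h p.1 ^ 2 •
        P.comp ((ContinuousLinearMap.inCoordinates E (TangentSpace I) (E →L[ℝ] ℝ)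
          (fun x : B => TangentSpace I x →L[ℝ] ℝ) p₀.2 p.2 p₀.2 p.2 (gB.inner p.2)).comp
            (ContinuousLinearMap.snd ℝ ℝ E))) p₀ :=
    contMDiffAt_const.add (hr.smul (contMDiffAt_const.clm_comp (hB2.clm_comp contMDiffAt_const)))
  refine hL.congr_of_eventuallyEq ?_
  have hn : ∀ᶠ p : ℝ × B in nhds p₀, p.2 ∈ (chartAt H p₀.2).source :=
    continuousAt_snd.eventually (chart_source_mem_nhds H p₀.2)
  filter_upwards [hn] with p hp
  have hp0 : ∀ p : ℝ × B, p.2 ∈ (chartAt H p₀.2).source →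
      p ∈ (chartAt (ModelProd ℝ H) p₀).source := by
    intro p hp; simpa [chartAt_self_eq] using hp
  refine ContinuousLinearMap.ext fun v => ContinuousLinearMap.ext fun w => ?_
  have e1 := inCoordinates_apply_eq₂ (x₀ := p₀) (x := p) (F₁ := ℝ × E)
    (F₂ := ℝ × E) (F₃ := ℝ) (E₁ := TangentSpace (𝓘(ℝ, ℝ).prod I))
    (E₂ := TangentSpace (𝓘(ℝ, ℝ).prod I)) (E₃ := Bundle.Trivial (ℝ × B) ℝ)
    (ϕ := warpedInner gB h p) (v := v) (w := w) (hp0 p hp) (hp0 p hp) (Set.mem_univ _)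
  have e2 := inCoordinates_apply_eq₂ (x₀ := p₀.2) (x := p.2) (F₁ := E)
    (F₂ := E) (F₃ := ℝ) (E₁ := TangentSpace I) (E₂ := TangentSpace I) (E₃ := Bundle.Trivial B ℝ)
    (ϕ := gB.inner p.2) (v := v.2) (w := w.2) hp hp (Set.mem_univ _)
  rw [symm_trivializationAt_prod p₀ p hp, symm_trivializationAt_prod p₀ p hp] at e1
  have e3 := congrArg (fun t : ℝ => v.1 * w.1 + h p.1 ^ 2 * t) e2
  refine e1.trans (Eq.trans ?_ e3.symm)
  simp
  rfl

/-- The warped product metric `dr² + h² g_B` on `ℝ × B`, for a smooth positive function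
`h` of `r ∈ ℝ`. -/
def warpedProduct
    (gB : Bundle.ContMDiffRiemannianMetric I ∞ E (fun x : B => TangentSpace I x))
    (h : ℝ → ℝ) (hh : ContDiff ℝ ∞ h) (hpos : ∀ r, 0 < h r) :
    Bundle.ContMDiffRiemannianMetric (𝓘(ℝ, ℝ).prod I) ∞ (ℝ × E)
      (fun p : ℝ × B => TangentSpace (𝓘(ℝ, ℝ).prod I) p) where
  inner p := warpedInner gB h p
  symm p v w := by
    rw [warpedInner_apply, warpedInner_apply, gB.symm p.2 v.2 w.2, mul_comm v.1]
  pos p v hv := warpedInner_pos gB h (hpos p.1) v hv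
  isVonNBounded p := isVonNBounded_warpedInner gB h (hpos p.1)
  contMDiff := contMDiff_warpedInner gB hh

end Warped
end RiemannianGeometry

end

/-! For u = (a, x) and v = (b, y), put A = |x|²|y|² - ⟨x, y⟩² and Q = |b x - a y|², measured in
`gB`. In the warped metric, u and v span a squared area h²Q + h⁴A, and ⟨R(u, v)v, u⟩ = h²⟨R_B(x,
y)y, x⟩ - h²h'²A - h h''Q. The sectional curvature is thus a weighted mean of (K_B - h'²)/h² and
-h''/h with weights h⁴A and h²Q, and only the second value occurs if A = 0.

It is negative as soon as h' and h'' are positive. It is bounded below if h is bounded away from 0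
and h'/h, h''/h are bounded. The function exp fails only in that K_B/h² may be unbounded as r → -∞.
Adding a small multiple of a bump function of e^r repairs this without losing h', h'' > 0
(`exists_warping_function`).

The curvature formula is `warpedCoord_coordCurvature`, computed in coordinates.
`chartMetric_warpedProduct` carries it to the manifold, and `warped_quotient_bounds` gives the
estimates. -/

noncomputable section

namespace RiemannianGeometry

/-! ### Levi-Civita calculus in coordinates -/

section Coordinates

variable {E : Type*} [NormedAddCommGroup E] [NormedSpace ℝ E]

local instance instNormedAddCommGroupBilin : NormedAddCommGroup (E →L[ℝ] E →L[ℝ] ℝ) :=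
  ContinuousLinearMap.toNormedAddCommGroup

local instance instNormedSpaceBilin : NormedSpace ℝ (E →L[ℝ] E →L[ℝ] ℝ) :=
  ContinuousLinearMap.toNormedSpace

local instance instNormedAddCommGroupTrilin : NormedAddCommGroup (E →L[ℝ] E →L[ℝ] E →L[ℝ] ℝ) :=
  ContinuousLinearMap.toNormedAddCommGroup

local instance instNormedSpaceTrilin : NormedSpace ℝ (E →L[ℝ] E →L[ℝ] E →L[ℝ] ℝ) :=
  ContinuousLinearMap.toNormedSpace

/-- Definiteness makes `b` injective, and E and its dual have the same finite dimension. -/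
theorem isInvertible_of_posDef [FiniteDimensional ℝ E] {b : E →L[ℝ] E →L[ℝ] ℝ}
    (hb : ∀ v, v ≠ 0 → 0 < b v v) : b.IsInvertible := by
  have hinj : Function.Injective b := by
    refine (injective_iff_map_eq_zero b).2 fun v hv => ?_
    by_contra h0
    have h1 := hb v h0
    rw [hv] at h1
    exact lt_irrefl _ h1
  let e : E →ₗ[ℝ] Module.Dual ℝ E :=
    (LinearMap.toContinuousLinearMap (𝕜 := ℝ) (E := E) (F' := ℝ)).symm.toLinearMap ∘ₗ b.toLinearMap
  have hfin : Module.finrank ℝ E = Module.finrank ℝ (E →L[ℝ] ℝ) :=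
    (Subspace.dual_finrank_eq (K := ℝ) (V := E)).symm.trans
      (LinearMap.toContinuousLinearMap (𝕜 := ℝ) (E := E) (F' := ℝ)).finrank_eq
  exact ⟨(LinearEquiv.ofInjectiveOfFinrankEq b.toLinearMap hinj hfin).toContinuousLinearEquiv,
    rfl⟩

theorem christoffel_spec {G : E → E →L[ℝ] E →L[ℝ] ℝ} {y : E} (hG : (G y).IsInvertible)
    (u v w : E) :
    2 * G y (christoffel G y u v) w =
      fderiv ℝ G y u v w + fderiv ℝ G y v u w - fderiv ℝ G y w u v := by
  rw [christoffel, hG.self_apply_inverse]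
  simp

/-- Nondegeneracy gives uniqueness, so a guessed connection can be verified without inverting the
metric. -/
theorem christoffel_eq_of_spec {G : E → E →L[ℝ] E →L[ℝ] ℝ} {y : E} (hG : (G y).IsInvertible)
    {u v c : E} (hc : ∀ w, 2 * G y c w =
      fderiv ℝ G y u v w + fderiv ℝ G y v u w - fderiv ℝ G y w u v) :
    christoffel G y u v = c := by
  rw [← hG.inverse_apply_self c, christoffel]
  congr 1
  ext w
  have := hc w
  simp
  linarith

/-- No invertibility is needed here: `inverse` is a linear map even where it takes its default value
0. -/
theorem christoffel_smul_left (G : E → E →L[ℝ] E →L[ℝ] ℝ) (y : E) (c : ℝ) (u v : E) :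
    christoffel G y (c • u) v = c • christoffel G y u v := by
  rw [christoffel, christoffel, ← map_smul, smul_comm c]
  congr 2
  ext w
  simp
  ring

theorem christoffel_add_right (G : E → E →L[ℝ] E →L[ℝ] ℝ) (y u v v' : E) :
    christoffel G y u (v + v') = christoffel G y u v + christoffel G y u v' := by
  rw [christoffel, christoffel, christoffel, ← map_add, ← smul_add]
  congr 2
  ext w
  simp
  ring

theorem christoffel_smul_right (G : E → E →L[ℝ] E →L[ℝ] ℝ) (y : E) (c : ℝ) (u v : E) :
    christoffel G y u (c • v) = c • christoffel G y u v := by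
  rw [christoffel, christoffel, ← map_smul, smul_comm c]
  congr 2
  ext w
  simp
  ring

theorem fderiv_apply₂ {F : Type*} [NormedAddCommGroup F] [NormedSpace ℝ F]
    {G : F → E →L[ℝ] E →L[ℝ] ℝ} {y : F} (hG : DifferentiableAt ℝ G y) (u : F) (v w : E) :
    fderiv ℝ (fun z => G z v w) y u = fderiv ℝ G y u v w := by
  have h := (hG.hasFDerivAt.clm_apply (hasFDerivAt_const v y)).clm_apply (hasFDerivAt_const w y)
  rw [h.fderiv]
  simp

theorem fderiv_symm {G : E → E →L[ℝ] E →L[ℝ] ℝ} {y : E} (hG : DifferentiableAt ℝ G y)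
    (hs : ∀ z v w, G z v w = G z w v) (u v w : E) :
    fderiv ℝ G y u v w = fderiv ℝ G y u w v := by
  rw [← fderiv_apply₂ hG, ← fderiv_apply₂ hG]
  simp_rw [hs _ v w]

theorem christoffel_comm {G : E → E →L[ℝ] E →L[ℝ] ℝ} {y : E} (hG : DifferentiableAt ℝ G y)
    (hs : ∀ z v w, G z v w = G z w v) (u v : E) :
    christoffel G y u v = christoffel G y v u := by
  rw [christoffel, christoffel]
  congr 2
  ext w
  have := fderiv_symm hG hs w u v
  simp
  linarith

/-- The Levi-Civita connection is compatible with the metric. -/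
theorem fderiv_eq_christoffel {G : E → E →L[ℝ] E →L[ℝ] ℝ} {y : E} (hG : DifferentiableAt ℝ G y)
    (hs : ∀ z v w, G z v w = G z w v) (hi : (G y).IsInvertible) (u v w : E) :
    fderiv ℝ G y u v w = G y (christoffel G y u v) w + G y (christoffel G y u w) v := by
  have h1 := christoffel_spec hi u v w
  have h2 := christoffel_spec hi u w v
  have := fderiv_symm hG hs u v w
  have := fderiv_symm hG hs v u w
  have := fderiv_symm hG hs w u v
  linarith

theorem differentiableAt_christoffel [CompleteSpace E] {G : E → E →L[ℝ] E →L[ℝ] ℝ} {y : E}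
    (hG : ContDiffAt ℝ ∞ G y) (hi : (G y).IsInvertible) (v w : E) :
    DifferentiableAt ℝ (fun z => christoffel G z v w) y := by
  have h1 : DifferentiableAt ℝ (fun z => (G z).inverse) y :=
    ((hi.contDiffAt_map_inverse (n := 1)).differentiableAt one_ne_zero).comp y
      (hG.differentiableAt (by simp))
  have h2 : DifferentiableAt ℝ (fderiv ℝ G) y :=
    (hG.fderiv_right (m := 1) (by norm_cast)).differentiableAt one_ne_zero
  have h3 : DifferentiableAt ℝ (fun z => (fderiv ℝ G z).flip v) y :=
    ((ContinuousLinearMap.flipₗᵢ ℝ E E (E →L[ℝ] ℝ)).differentiableAt.comp y h2).clm_apply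
      (differentiableAt_const v)
  have h4 : DifferentiableAt ℝ (fun z => ((fderiv ℝ G z).flip v).flip w) y :=
    ((ContinuousLinearMap.flipₗᵢ ℝ E E ℝ).differentiableAt.comp y h3).clm_apply
      (differentiableAt_const w)
  have h5 : ∀ a b : E, DifferentiableAt ℝ (fun z => fderiv ℝ G z a b) y := fun a b =>
    (h2.clm_apply (differentiableAt_const a)).clm_apply (differentiableAt_const b)
  exact h1.clm_apply ((((h5 v w).add (h5 w v)).sub h4).const_smul (1 / 2 : ℝ))

theorem christoffel_congr {G G' : E → E →L[ℝ] E →L[ℝ] ℝ} {y : E} (h : G =ᶠ[nhds y] G') (u v : E) :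
    christoffel G y u v = christoffel G' y u v := by
  rw [christoffel, christoffel, h.fderiv_eq, h.eq_of_nhds]

/-- The Christoffel symbols are differentiated once more, so they must agree near y and not only at
y. -/
theorem coordCurvature_congr {G G' : E → E →L[ℝ] E →L[ℝ] ℝ} {y : E} (h : G =ᶠ[nhds y] G')
    (u v w : E) : coordCurvature G y u v w = coordCurvature G' y u v w := by
  have h1 : ∀ a b, (fun z => christoffel G z a b) =ᶠ[nhds y] fun z => christoffel G' z a b :=
    fun a b => h.eventuallyEq_nhds.mono fun z hz => christoffel_congr hz a b
  simp only [coordCurvature, (h1 _ _).fderiv_eq, christoffel_congr h]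

theorem coordCurvature_smul_self [CompleteSpace E] {G : E → E →L[ℝ] E →L[ℝ] ℝ} {y : E}
    (hG : ContDiffAt ℝ ∞ G y) (hi : (G y).IsInvertible) (c : ℝ) (v : E) :
    coordCurvature G y (c • v) v v = 0 := by
  simp only [coordCurvature, christoffel_smul_left, christoffel_smul_right, map_smul]
  rw [fderiv_fun_const_smul (differentiableAt_christoffel hG hi v v)]
  simp

theorem coordCurvature_zero (G : E → E →L[ℝ] E →L[ℝ] ℝ) (y u : E) :
    coordCurvature G y u 0 0 = 0 := by
  have h : ∀ z a, christoffel G z a 0 = 0 := fun z a => by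
    simpa using christoffel_smul_right G z 0 a 0
  simp [coordCurvature, h]

/-- Independent vectors of the product may have dependent projections to the base. Sectional
curvature bounds say nothing there, but the curvature term vanishes. -/
theorem coordCurvature_eq_zero_of_not_linearIndependent [CompleteSpace E]
    {G : E → E →L[ℝ] E →L[ℝ] ℝ} {y : E} (hG : ContDiffAt ℝ ∞ G y) (hi : (G y).IsInvertible)
    {u v : E} (h : ¬ LinearIndependent ℝ ![u, v]) : coordCurvature G y u v v = 0 := by
  by_cases hv : v = 0
  · rw [hv, coordCurvature_zero]
  · rw [linearIndependent_fin2] at h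
    simp only [Matrix.cons_val_one, Matrix.cons_val_zero, Matrix.cons_val_fin_one, ne_eq, hv,
      not_false_eq_true, true_and, not_forall, not_not] at h
    obtain ⟨c, rfl⟩ := h
    exact coordCurvature_smul_self hG hi c v

/-! ### Connection and curvature of the warped metric in coordinates -/

/-- The coordinate expression `dr² + h(r)² G` of a warped product metric. -/
def warpedCoord (h : ℝ → ℝ) (G : E → E →L[ℝ] E →L[ℝ] ℝ) (p : ℝ × E) :
    (ℝ × E) →L[ℝ] (ℝ × E) →L[ℝ] ℝ :=
  (ContinuousLinearMap.mul ℝ ℝ).bilinearComp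
      (ContinuousLinearMap.fst ℝ ℝ E) (ContinuousLinearMap.fst ℝ ℝ E)
    + h p.1 ^ 2 • (G p.2).bilinearComp
      (ContinuousLinearMap.snd ℝ ℝ E) (ContinuousLinearMap.snd ℝ ℝ E)

theorem warpedCoord_apply (h : ℝ → ℝ) (G : E → E →L[ℝ] E →L[ℝ] ℝ) (p v w : ℝ × E) :
    warpedCoord h G p v w = v.1 * w.1 + h p.1 ^ 2 * G p.2 v.2 w.2 := rfl

theorem warpedCoord_posDef {h : ℝ → ℝ} {G : E → E →L[ℝ] E →L[ℝ] ℝ} {p : ℝ × E}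
    (hh : h p.1 ≠ 0) (hG : ∀ v, v ≠ 0 → 0 < G p.2 v v) (v : ℝ × E) (hv : v ≠ 0) :
    0 < warpedCoord h G p v v := by
  rw [warpedCoord_apply]
  have hh' : 0 < h p.1 ^ 2 := by positivity
  by_cases h2 : v.2 = 0
  · have h1 : v.1 ≠ 0 := fun h1 => hv (Prod.ext h1 h2)
    rw [h2]
    simpa using h1
  · have := hG _ h2
    have := mul_self_nonneg v.1
    positivity

theorem differentiableAt_warpedCoord {h : ℝ → ℝ} {G : E → E →L[ℝ] E →L[ℝ] ℝ} {p : ℝ × E}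
    (hh : DifferentiableAt ℝ h p.1) (hG : DifferentiableAt ℝ G p.2) :
    DifferentiableAt ℝ (warpedCoord h G) p := by
  -- Precomposition with the projection to E, which exhibits the pullback of `G` as a composition of
  -- continuous linear maps.
  let P : (E →L[ℝ] ℝ) →L[ℝ] ((ℝ × E) →L[ℝ] ℝ) :=
    (ContinuousLinearMap.compL ℝ (ℝ × E) E ℝ).flip (ContinuousLinearMap.snd ℝ ℝ E)
  have h1 : DifferentiableAt ℝ (fun p : ℝ × E => h p.1 ^ 2) p :=
    (hh.comp p differentiableAt_fst).pow 2
  have h2 : DifferentiableAt ℝ (fun p : ℝ × E => G p.2) p := DifferentiableAt.comp p (g := G) (f := Prod.snd) hG differentiableAt_snd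
  exact (differentiableAt_const _).add
    (h1.smul ((differentiableAt_const P).clm_comp (h2.clm_comp (differentiableAt_const _))))

theorem fderiv_warpedCoord {h : ℝ → ℝ} {G : E → E →L[ℝ] E →L[ℝ] ℝ} {p : ℝ × E}
    (hh : DifferentiableAt ℝ h p.1) (hG : DifferentiableAt ℝ G p.2) (u v w : ℝ × E) :
    fderiv ℝ (warpedCoord h G) p u v w =
      2 * h p.1 * deriv h p.1 * u.1 * G p.2 v.2 w.2
        + h p.1 ^ 2 * fderiv ℝ G p.2 u.2 v.2 w.2 := by
  rw [← fderiv_apply₂ (differentiableAt_warpedCoord hh hG)]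
  simp only [warpedCoord_apply]
  have h1 : HasFDerivAt (fun p : ℝ × E => h p.1) _ p :=
    (hh.hasDerivAt.hasFDerivAt).comp p hasFDerivAt_fst
  have h2 : HasFDerivAt (fun p : ℝ × E => G p.2) _ p :=
    HasFDerivAt.comp p (g := G) (f := Prod.snd) hG.hasFDerivAt hasFDerivAt_snd
  have h3 := (h2.clm_apply (hasFDerivAt_const v.2 p)).clm_apply (hasFDerivAt_const w.2 p)
  refine (congrArg (fun L => L u) (((h1.pow 2).mul h3).const_add (v.1 * w.1)).fderiv).trans ?_
  simp
  ring

/-- The stated vector satisfies the Koszul identity, whose base part is that of `G`;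
`christoffel_eq_of_spec` concludes. -/
theorem christoffel_warpedCoord [FiniteDimensional ℝ E] {h : ℝ → ℝ}
    {G : E → E →L[ℝ] E →L[ℝ] ℝ} {p : ℝ × E}
    (hh : DifferentiableAt ℝ h p.1) (h0 : h p.1 ≠ 0) (hG : DifferentiableAt ℝ G p.2)
    (hpos : ∀ v, v ≠ 0 → 0 < G p.2 v v) (u v : ℝ × E) :
    christoffel (warpedCoord h G) p u v =
      (-(h p.1 * deriv h p.1 * G p.2 u.2 v.2),
        christoffel G p.2 u.2 v.2 + (deriv h p.1 / h p.1) • (u.1 • v.2 + v.1 • u.2)) := by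
  refine christoffel_eq_of_spec (isInvertible_of_posDef (warpedCoord_posDef h0 hpos)) fun w => ?_
  have h1 := christoffel_spec (isInvertible_of_posDef hpos) u.2 v.2 w.2
  simp only [fderiv_warpedCoord hh hG, warpedCoord_apply, map_add, map_smul, add_apply, smul_apply,
    smul_eq_mul]
  field_simp
  linear_combination h p.1 * h1

/-- The three terms are the curvature of the base, the second fundamental form of the slices r =
const, and the radial curvature. Positivity is assumed near `p.2` because the formula for the
Christoffel symbols gets differentiated. -/
theorem warpedCoord_coordCurvature [FiniteDimensional ℝ E] {h : ℝ → ℝ} (hh : ContDiff ℝ ∞ h)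
    (h0 : ∀ r, h r ≠ 0) {G : E → E →L[ℝ] E →L[ℝ] ℝ} {p : ℝ × E} (hG : ContDiffAt ℝ ∞ G p.2)
    (hs : ∀ z v w, G z v w = G z w v) (hpos : ∀ᶠ y in nhds p.2, ∀ v, v ≠ 0 → 0 < G y v v)
    (u v : ℝ × E) :
    warpedCoord h G p (coordCurvature (warpedCoord h G) p u v v) u =
      h p.1 ^ 2 * G p.2 (coordCurvature G p.2 u.2 v.2 v.2) u.2
      - h p.1 ^ 2 * deriv h p.1 ^ 2 *
        (G p.2 u.2 u.2 * G p.2 v.2 v.2 - G p.2 u.2 v.2 ^ 2)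
      - h p.1 * deriv (deriv h) p.1 *
        G p.2 (v.1 • u.2 - u.1 • v.2) (v.1 • u.2 - u.1 • v.2) := by
  have : CompleteSpace E := FiniteDimensional.complete ℝ E
  have hd : Differentiable ℝ h := hh.differentiable (by simp)
  have hd' : Differentiable ℝ (deriv h) :=
    (contDiff_infty_iff_deriv.1 hh).2.differentiable (by simp)
  have hi := isInvertible_of_posDef hpos.self_of_nhds
  have hGd : DifferentiableAt ℝ G p.2 := hG.differentiableAt (by simp)
  have hev : ∀ᶠ q : ℝ × E in nhds p, DifferentiableAt ℝ G q.2 ∧ ∀ v, v ≠ 0 → 0 < G q.2 v v := by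
    have h1 : ∀ᶠ y in nhds p.2, DifferentiableAt ℝ G y :=
      ((hG.of_le (m := 1) (by norm_cast)).eventually (by simp)).mono
        fun y hy => hy.differentiableAt one_ne_zero
    exact continuousAt_snd.eventually (h1.and hpos)
  have hchr : ∀ a b : ℝ × E, (fun q => christoffel (warpedCoord h G) q a b) =ᶠ[nhds p] fun q =>
      (-(h q.1 * deriv h q.1 * G q.2 a.2 b.2),
        christoffel G q.2 a.2 b.2 + (deriv h q.1 / h q.1) • (a.1 • b.2 + b.1 • a.2)) :=
    fun a b => hev.mono fun q hq =>
      christoffel_warpedCoord (hd _) (h0 _) hq.1 hq.2 a b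
  have hfd : ∀ a b c : ℝ × E, fderiv ℝ (fun q => christoffel (warpedCoord h G) q a b) p c =
      (-((deriv h p.1 ^ 2 + h p.1 * deriv (deriv h) p.1) * c.1 * G p.2 a.2 b.2
        + h p.1 * deriv h p.1 * fderiv ℝ G p.2 c.2 a.2 b.2),
        fderiv ℝ (fun y => christoffel G y a.2 b.2) p.2 c.2
          + (c.1 * ((deriv (deriv h) p.1 * h p.1 - deriv h p.1 ^ 2) / h p.1 ^ 2)) •
            (a.1 • b.2 + b.1 • a.2)) := by
    intro a b c
    have h1 : HasFDerivAt (fun q : ℝ × E => h q.1 * deriv h q.1) _ p :=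
      (((hd p.1).hasDerivAt.mul (hd' p.1).hasDerivAt).hasFDerivAt).comp p hasFDerivAt_fst
    have h2 : HasFDerivAt (fun p : ℝ × E => G p.2) _ p :=
      HasFDerivAt.comp p (g := G) (f := Prod.snd) hGd.hasFDerivAt hasFDerivAt_snd
    have h3 := (h2.clm_apply (hasFDerivAt_const a.2 p)).clm_apply (hasFDerivAt_const b.2 p)
    have h4 : HasFDerivAt (fun q : ℝ × E => christoffel G q.2 a.2 b.2) _ p :=
      (differentiableAt_christoffel hG hi a.2 b.2).hasFDerivAt.comp p hasFDerivAt_snd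
    have h5 : HasFDerivAt (fun q : ℝ × E => deriv h q.1 / h q.1) _ p :=
      (((hd' p.1).hasDerivAt.div (hd p.1).hasDerivAt (h0 _)).hasFDerivAt).comp p hasFDerivAt_fst
    have h6 := ((h1.mul h3).neg).prodMk (h4.add (h5.smul_const (a.1 • b.2 + b.1 • a.2)))
    rw [(hchr a b).fderiv_eq]
    refine (congrArg (fun L => L c) h6.fderiv).trans ?_
    ext
    · simp
      ring
    · simp [mul_comm, pow_two]
  have hc := christoffel_comm hGd hs
  -- Metric compatibility turns derivatives of `G` into Christoffel terms, which then cancel.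
  have hm := fderiv_eq_christoffel hGd hs hi
  have hsy := hs p.2
  have hp1 : h p.1 ≠ 0 := h0 _
  simp only [coordCurvature, hfd, christoffel_warpedCoord (hd p.1) hp1 hGd hpos.self_of_nhds,
    warpedCoord_apply, christoffel_add_right, christoffel_smul_right, map_add, map_sub, map_smul, add_apply, sub_apply, smul_apply,
    smul_eq_mul, hm]
  -- Equal terms are brought to one order of arguments, so that `ring` can identify them.
  rw [hc v.2 u.2, hsy v.2 u.2, hsy u.2 (christoffel G p.2 v.2 v.2),
    hsy v.2 (christoffel G p.2 u.2 v.2)]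
  field_simp
  ring

end Coordinates

/-! ### Metric and curvature in the preferred chart -/

section Charts

variable {E : Type*} [NormedAddCommGroup E] [NormedSpace ℝ E]
  {H : Type*} [TopologicalSpace H] {I : ModelWithCorners ℝ E H} [I.Boundaryless]
  {M : Type*} [TopologicalSpace M] [ChartedSpace H M] [IsManifold I ∞ M]

/-- Links `chartMetric`, defined by derivatives of the chart, to the bundle trivialization in which
smoothness of a metric is expressed. -/
theorem mfderiv_extChartAt_symm {x : M} {y : E} (hy : y ∈ (extChartAt I x).target) :
    mfderiv 𝓘(ℝ, E) I (extChartAt I x).symm y =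
      (trivializationAt E (TangentSpace I) x).symmL ℝ ((extChartAt I x).symm y) := by
  have : IsManifold I 1 M := IsManifold.of_le (n := ∞) (by norm_cast)
  have hx : (extChartAt I x).symm y ∈ (chartAt H x).source := by
    simpa using (extChartAt I x).map_target hy
  rw [TangentBundle.symmL_trivializationAt hx, (extChartAt I x).right_inv hy, I.range_eq_univ,
    mfderivWithin_univ]

theorem chartMetric_apply
    (g : Bundle.ContMDiffRiemannianMetric I ∞ E (fun x : M => TangentSpace I x))
    {x : M} {y : E} (hy : y ∈ (extChartAt I x).target) (v w : E) :
    chartMetric g x y v w = g.inner ((extChartAt I x).symm y)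
      ((trivializationAt E (TangentSpace I) x).symm ((extChartAt I x).symm y) v)
      ((trivializationAt E (TangentSpace I) x).symm ((extChartAt I x).symm y) w) := by
  have hx : (extChartAt I x).symm y ∈ (chartAt H x).source := by
    simpa using (extChartAt I x).map_target hy
  have h : ∀ a : E, mfderiv 𝓘(ℝ, E) I (extChartAt I x).symm y a =
      (trivializationAt E (TangentSpace I) x).symm ((extChartAt I x).symm y) a := fun a =>
    (congrArg (fun f => f a) (mfderiv_extChartAt_symm (I := I) hy)).trans
      (Bundle.Trivialization.symmL_apply _ hx a)
  rw [← h v, ← h w]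
  rfl

omit [I.Boundaryless] in
theorem chartMetric_symm
    (g : Bundle.ContMDiffRiemannianMetric I ∞ E (fun x : M => TangentSpace I x))
    (x : M) (y v w : E) : chartMetric g x y v w = chartMetric g x y w v :=
  g.symm ((extChartAt I x).symm y) (mfderiv 𝓘(ℝ, E) I (extChartAt I x).symm y v)
    (mfderiv 𝓘(ℝ, E) I (extChartAt I x).symm y w)

omit [I.Boundaryless] in
theorem symm_trivializationAt_self (x : M) (v : E) :
    (trivializationAt E (TangentSpace I) x).symm x v = v := by
  have hx : x ∈ (chartAt H x).source := mem_chart_source H x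
  have e := congrArg (fun f => f v)
    (TangentBundle.symmL_trivializationAt_eq_core (𝕜 := ℝ) (I := I) hx)
  exact ((Bundle.Trivialization.symmL_apply _ hx v).symm.trans e).trans
    ((tangentBundleCore I M).coordChange_self (achart H x) x hx v)

theorem chartMetric_self
    (g : Bundle.ContMDiffRiemannianMetric I ∞ E (fun x : M => TangentSpace I x))
    (x : M) (v w : TangentSpace I x) :
    chartMetric g x (extChartAt I x x) v w = g.inner x v w := by
  refine (chartMetric_apply g (mem_extChartAt_target x) v w).trans ?_
  rw [extChartAt_to_inv x]
  exact congrArg₂ (fun a b : E => g.inner x a b) (symm_trivializationAt_self (E := E) x v)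
    (symm_trivializationAt_self (E := E) x w)

/-- The trivialization is invertible on fibres over the chart domain, so nonzero coordinate vectors
represent nonzero tangent vectors. -/
theorem eventually_chartMetric_pos
    (g : Bundle.ContMDiffRiemannianMetric I ∞ E (fun x : M => TangentSpace I x)) (x : M) :
    ∀ᶠ y in nhds (extChartAt I x x), ∀ v, v ≠ 0 → 0 < chartMetric g x y v v := by
  filter_upwards [extChartAt_target_mem_nhds x] with y hy v hv
  have hx : (extChartAt I x).symm y ∈ (trivializationAt E (TangentSpace I) x).baseSet := by
    simpa using (extChartAt I x).map_target hy
  rw [chartMetric_apply g hy]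
  refine g.pos _ _ fun h0 => hv ?_
  have h2 := (trivializationAt E (TangentSpace I) x).symmL_apply (R := ℝ) hx v
  have h3 := (trivializationAt E (TangentSpace I) x).continuousLinearMapAt_symmL (R := ℝ) hx v
  rw [h2, h0, map_zero] at h3
  exact h3.symm

theorem contDiffAt_chartMetric
    (g : Bundle.ContMDiffRiemannianMetric I ∞ E (fun x : M => TangentSpace I x)) (x : M) :
    ContDiffAt ℝ ∞ (chartMetric g x) (extChartAt I x x) := by
  have h1 := ((contMDiffAt_hom_bundle _).1 (g.contMDiff x)).2
  have h2 : ContMDiffAt 𝓘(ℝ, E) I ∞ (extChartAt I x).symm (extChartAt I x x) :=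
    (contMDiffOn_extChartAt_symm x).contMDiffAt (extChartAt_target_mem_nhds x)
  have h3 := ContMDiffAt.comp_of_eq h1 h2 (extChartAt_to_inv x)
  rw [contMDiffAt_iff_contDiffAt] at h3
  refine h3.congr_of_eventuallyEq ?_
  filter_upwards [extChartAt_target_mem_nhds x] with y hy
  have hx : (extChartAt I x).symm y ∈ (chartAt H x).source := by
    simpa using (extChartAt I x).map_target hy
  ext v w
  rw [chartMetric_apply g hy]
  refine Eq.trans ?_ (inCoordinates_apply_eq₂ (x₀ := x) (x := (extChartAt I x).symm y) (F₁ := E)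
    (F₂ := E) (F₃ := ℝ) (E₁ := TangentSpace I) (E₂ := TangentSpace I) (E₃ := Bundle.Trivial M ℝ)
    (ϕ := g.inner ((extChartAt I x).symm y)) (v := v) (w := w) hx hx (Set.mem_univ _)).symm
  simp

/-- The preferred chart at x has identity derivative at x, so tangent vectors are their own
coordinates. -/
theorem sectionalCurvature_eq
    (g : Bundle.ContMDiffRiemannianMetric I ∞ E (fun x : M => TangentSpace I x))
    (x : M) (u v : E) :
    sectionalCurvature g x u v =
      chartMetric g x (extChartAt I x x)
          (coordCurvature (chartMetric g x) (extChartAt I x x) u v v) u /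
        (chartMetric g x (extChartAt I x x) u u * chartMetric g x (extChartAt I x x) v v
          - chartMetric g x (extChartAt I x x) u v ^ 2) := by
  have : IsManifold I 1 M := IsManifold.of_le (n := ∞) (by norm_cast)
  have h : ∀ a : E, mfderiv I 𝓘(ℝ, E) (extChartAt I x) x a = a := fun a =>
    congrArg (fun f => f a) (mfderiv_extChartAt_self (I := I) (x := x))
  have e1 := chartMetric_self g x u v
  have e2 := chartMetric_self g x u u
  have e3 := chartMetric_self g x v v
  rw [e1, e2, e3]
  unfold sectionalCurvature
  dsimp only
  rw [h u, h v]

end Charts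

/-! ### The warped product in a product chart -/

section WarpedChart

variable {E : Type*} [NormedAddCommGroup E] [NormedSpace ℝ E]
  {H : Type*} [TopologicalSpace H] {I : ModelWithCorners ℝ E H} [I.Boundaryless]
  {B : Type*} [TopologicalSpace B] [ChartedSpace H B] [IsManifold I ∞ B]

omit [I.Boundaryless] [IsManifold I ∞ B] in
theorem extChartAt_real_prod (p q : ℝ × B) :
    extChartAt (𝓘(ℝ, ℝ).prod I) p q = (q.1, extChartAt I p.2 q.2) := by
  rw [extChartAt_prod]
  simp [chartAt_self_eq]

/-- The preferred chart of ℝ × B is the identity times that of B, and its derivative leaves the ℝ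
component alone. -/
theorem chartMetric_warpedProduct
    (gB : Bundle.ContMDiffRiemannianMetric I ∞ E (fun x : B => TangentSpace I x))
    (h : ℝ → ℝ) (hh : ContDiff ℝ ∞ h) (hpos : ∀ r, 0 < h r) (p : ℝ × B) :
    chartMetric (warpedProduct gB h hh hpos) p
      =ᶠ[nhds (extChartAt (𝓘(ℝ, ℝ).prod I) p p)] warpedCoord h (chartMetric gB p.2) := by
  filter_upwards [extChartAt_target_mem_nhds p] with y hy
  have hy2 : y.2 ∈ (extChartAt I p.2).target := by
    rw [extChartAt_prod] at hy
    exact hy.2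
  have hsy : (extChartAt (𝓘(ℝ, ℝ).prod I) p).symm y = (y.1, (extChartAt I p.2).symm y.2) := by
    rw [extChartAt_prod]
    simp [chartAt_self_eq]
  have hx : (extChartAt I p.2).symm y.2 ∈ (chartAt H p.2).source := by
    simpa using (extChartAt I p.2).map_target hy2
  refine ContinuousLinearMap.ext fun v => ContinuousLinearMap.ext fun w => ?_
  rw [chartMetric_apply _ hy, warpedCoord_apply, chartMetric_apply gB hy2, hsy,
    symm_trivializationAt_prod p _ hx, symm_trivializationAt_prod p _ hx]
  rfl

end WarpedChart

/-! ### The warping function -/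

theorem exists_bound_of_hasCompactSupport {f : ℝ → ℝ} (hf : Continuous f)
    (hc : HasCompactSupport f) : ∃ C, 0 ≤ C ∧ ∀ x, |f x| ≤ C := by
  obtain ⟨C, hC⟩ := hc.exists_bound_of_continuous hf
  exact ⟨C, (norm_nonneg _).trans (hC 0), hC⟩

/-- There is a smooth convex function agreeing with `exp` near `+∞`, bounded away from `0`, whose
first two derivatives are positive and bounded by multiples of the function. -/
theorem exists_warping_function :
    ∃ (h : ℝ → ℝ) (L : ℝ), ContDiff ℝ ∞ h ∧ (∀ r, 0 < h r) ∧ (∀ r, 0 < deriv h r) ∧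
      (∀ r, 0 < deriv (deriv h) r) ∧ (∃ R : ℝ, ∀ r : ℝ, R ≤ r → h r = Real.exp r) ∧
      (∀ r, 1 ≤ L * h r) ∧ (∀ r, deriv h r ≤ L * h r) ∧ (∀ r, deriv (deriv h) r ≤ L * h r) := by
  -- ψ is 1 on [-1, 1] and 0 outside (-2, 2).
  let ψ : ContDiffBump (0 : ℝ) := ⟨1, 2, one_pos, one_lt_two⟩
  have hψ : ContDiff ℝ ∞ ψ := ψ.contDiff
  have hψ' : ContDiff ℝ ∞ (deriv ψ) := (contDiff_infty_iff_deriv.1 hψ).2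
  have hψ'' : ContDiff ℝ ∞ (deriv (deriv ψ)) := (contDiff_infty_iff_deriv.1 hψ').2
  have hc : HasCompactSupport ψ := ψ.hasCompactSupport
  obtain ⟨C₁, hC₁, h1⟩ := exists_bound_of_hasCompactSupport hψ'.continuous hc.deriv
  obtain ⟨C₂, hC₂, h2⟩ := exists_bound_of_hasCompactSupport
    (f := fun x => x * deriv (deriv ψ) x) (continuous_id.mul hψ''.continuous)
    (hc.deriv.deriv.mul_left)
  -- Small enough that δψ' and δxψ'', the corrections that enter h' and h'', have absolute values
  -- adding up to at most 1/2.
  set δ : ℝ := 1 / (2 * (C₁ + C₂ + 1)) with hδdef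
  have hδ : 0 < δ := by positivity
  have hδC : δ * (C₁ + C₂ + 1) = 1 / 2 := by rw [hδdef]; field_simp
  have hδC₁ : ∀ x, |δ * deriv ψ x| + |δ * (x * deriv (deriv ψ) x)| ≤ 1 / 2 := by
    intro x
    rw [abs_mul, abs_mul, abs_of_pos hδ]
    nlinarith [h1 x, h2 x]
  -- Equal to e^r + δ for r ≤ 0 and to e^r once e^r ≥ 2.
  let h : ℝ → ℝ := fun r => Real.exp r + δ * ψ (Real.exp r)
  have hd : ∀ r, HasDerivAt h (Real.exp r * (1 + δ * deriv ψ (Real.exp r))) r := by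
    intro r
    have a := ((hψ.differentiable (by simp)) (Real.exp r)).hasDerivAt.comp r (Real.hasDerivAt_exp r)
    exact ((Real.hasDerivAt_exp r).add (a.const_mul δ)).congr_deriv (by ring)
  have hd1 : deriv h = fun r => Real.exp r * (1 + δ * deriv ψ (Real.exp r)) :=
    funext fun r => (hd r).deriv
  have hd2 : ∀ r, deriv (deriv h) r = Real.exp r *
      (1 + δ * deriv ψ (Real.exp r) + δ * (Real.exp r * deriv (deriv ψ) (Real.exp r))) := by
    intro r
    rw [hd1]
    have a := ((hψ'.differentiable (by simp)) (Real.exp r)).hasDerivAt.comp r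
      (Real.hasDerivAt_exp r)
    exact ((Real.hasDerivAt_exp r).mul ((a.const_mul δ).const_add 1)).deriv.trans (by
      simp only [Function.comp_apply]; ring)
  have hexp : ∀ r, Real.exp r ≤ h r := fun r => by
    have := ψ.nonneg' (Real.exp r)
    exact le_add_of_nonneg_right (by positivity)
  have hlow : ∀ r, min δ 1 ≤ h r := fun r => by
    by_cases hr : Real.exp r ≤ 1
    · have : ψ (Real.exp r) = 1 := ψ.one_of_mem_closedBall (by
        rw [mem_closedBall_zero_iff, Real.norm_of_nonneg (Real.exp_pos r).le]
        exact hr)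
      refine (min_le_left _ _).trans ?_
      simp only [h, this, mul_one]
      linarith [Real.exp_pos r]
    · exact (min_le_right _ _).trans ((not_le.1 hr).le.trans (hexp r))
  have hm : 0 < min δ 1 := lt_min hδ one_pos
  -- Hence h' and h'' both lie between e^r / 2 and 3e^r / 2.
  have hb : ∀ r, -(1 / 2) ≤ δ * deriv ψ (Real.exp r) ∧ δ * deriv ψ (Real.exp r) ≤ 1 / 2 ∧
      -(1 / 2) ≤ δ * deriv ψ (Real.exp r) + δ * (Real.exp r * deriv (deriv ψ) (Real.exp r)) ∧
      δ * deriv ψ (Real.exp r) + δ * (Real.exp r * deriv (deriv ψ) (Real.exp r)) ≤ 1 / 2 := by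
    intro r
    have a := hδC₁ (Real.exp r)
    have b1 := le_abs_self (δ * deriv ψ (Real.exp r))
    have b2 := neg_abs_le (δ * deriv ψ (Real.exp r))
    have b3 := le_abs_self (δ * (Real.exp r * deriv (deriv ψ) (Real.exp r)))
    have b4 := neg_abs_le (δ * (Real.exp r * deriv (deriv ψ) (Real.exp r)))
    have b5 := abs_nonneg (δ * deriv ψ (Real.exp r))
    have b6 := abs_nonneg (δ * (Real.exp r * deriv (deriv ψ) (Real.exp r)))
    refine ⟨?_, ?_, ?_, ?_⟩ <;> linarith
  have hpos : ∀ r, 0 < h r := fun r => (Real.exp_pos r).trans_le (hexp r)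
  -- With L = 2 / min δ 1, the bound h ≥ min δ 1 gives L h ≥ 2, and h ≥ e^r gives L h ≥ 2e^r, which
  -- dominates h' and h''.
  have hL : 2 ≤ 2 / min δ 1 := by
    rw [le_div_iff₀ hm]
    linarith [min_le_right δ 1]
  have hLh : ∀ r, 2 * Real.exp r ≤ 2 / min δ 1 * h r := fun r =>
    mul_le_mul hL (hexp r) (Real.exp_pos r).le (by positivity)
  refine ⟨h, 2 / min δ 1, Real.contDiff_exp.add (contDiff_const.mul (hψ.comp Real.contDiff_exp)),
    hpos, fun r => ?_, fun r => ?_, ⟨Real.log 2, fun r hr => ?_⟩, fun r => ?_, fun r => ?_,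
    fun r => ?_⟩
  · rw [(hd r).deriv]
    exact mul_pos (Real.exp_pos r) (by linarith [(hb r).1])
  · rw [hd2]
    exact mul_pos (Real.exp_pos r) (by linarith [(hb r).2.2.1])
  · have h2 : 2 ≤ Real.exp r := (Real.log_le_iff_le_exp two_pos).1 hr
    have : ψ (Real.exp r) = 0 := ψ.zero_of_le_dist (by
      rw [dist_zero_right, Real.norm_of_nonneg (Real.exp_pos r).le]
      exact h2)
    simp only [h, this, mul_zero, add_zero]
  · rw [div_mul_eq_mul_div, le_div_iff₀ hm]
    linarith [hlow r]
  · rw [(hd r).deriv]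
    refine le_trans ?_ (hLh r)
    nlinarith [(hb r).2.1, Real.exp_pos r]
  · rw [hd2]
    refine le_trans ?_ (hLh r)
    nlinarith [(hb r).2.2.2, Real.exp_pos r]

/-! ### Gram determinants and estimates of the quotient -/

section Gram

variable {E : Type*} [NormedAddCommGroup E] [NormedSpace ℝ E]

/-- The strict Cauchy-Schwarz inequality. -/
theorem gram_pos {b : E →L[ℝ] E →L[ℝ] ℝ} (hs : ∀ v w, b v w = b w v)
    (hb : ∀ v, v ≠ 0 → 0 < b v v) {u v : E} (h : LinearIndependent ℝ ![u, v]) :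
    0 < b u u * b v v - b u v ^ 2 := by
  have hv : 0 < b v v := hb v (h.ne_zero 1)
  -- This vector is b(v, v) times the component of u orthogonal to v; its square is b(v, v) times
  -- the Gram determinant.
  have hw : b v v • u - b u v • v ≠ 0 := fun h0 => by
    have := LinearIndependent.pair_iff.1 h (b v v) (-(b u v)) (by
      rw [neg_smul, ← sub_eq_add_neg, h0])
    exact hv.ne' this.1
  have h1 := hb _ hw
  simp only [map_sub, map_smul, sub_apply, smul_apply, smul_eq_mul] at h1
  rw [hs v u] at h1
  refine pos_of_mul_pos_right (a := b v v) ?_ hv.le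
  linarith

theorem gram_eq_zero {b : E →L[ℝ] E →L[ℝ] ℝ} {u v : E} (h : ¬ LinearIndependent ℝ ![u, v]) :
    b u u * b v v - b u v ^ 2 = 0 := by
  by_cases hv : v = 0
  · simp [hv]
  · rw [linearIndependent_fin2] at h
    simp only [Matrix.cons_val_one, Matrix.cons_val_zero, Matrix.cons_val_fin_one, ne_eq, hv,
      not_false_eq_true, true_and, not_forall, not_not] at h
    obtain ⟨c, rfl⟩ := h
    simp only [map_smul, smul_apply, smul_eq_mul]
    ring

theorem warpedCoord_gram (h : ℝ → ℝ) {G : E → E →L[ℝ] E →L[ℝ] ℝ}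
    (hs : ∀ z v w, G z v w = G z w v) (p u v : ℝ × E) :
    warpedCoord h G p u u * warpedCoord h G p v v - warpedCoord h G p u v ^ 2 =
      h p.1 ^ 2 * G p.2 (v.1 • u.2 - u.1 • v.2) (v.1 • u.2 - u.1 • v.2)
        + h p.1 ^ 4 * (G p.2 u.2 u.2 * G p.2 v.2 v.2 - G p.2 u.2 v.2 ^ 2) := by
  simp only [warpedCoord_apply, map_sub, map_smul, sub_apply, smul_apply, smul_eq_mul]
  rw [hs p.2 v.2 u.2]
  ring

end Gram

/-- The quotient of `K H² - (H H₁)² A - H H₂ Q` by `H² Q + H⁴ A` is negative and bounded below. -/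
theorem warped_quotient_bounds {K A Q H H₁ H₂ C L : ℝ} (hA : 0 ≤ A) (hQ : 0 ≤ Q) (hH : 0 < H)
    (hH₁ : 0 < H₁) (hH₂ : 0 < H₂) (hK : K ≤ 0) (hCK : C * A ≤ K) (hL : 1 ≤ L * H)
    (hL₁ : H₁ ≤ L * H) (hL₂ : H₂ ≤ L * H) (hD : 0 < H ^ 2 * Q + H ^ 4 * A) :
    (H ^ 2 * K - H ^ 2 * H₁ ^ 2 * A - H * H₂ * Q) / (H ^ 2 * Q + H ^ 4 * A) < 0 ∧
      -(L ^ 2 * (|C| + 1) + L) ≤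
        (H ^ 2 * K - H ^ 2 * H₁ ^ 2 * A - H * H₂ * Q) / (H ^ 2 * Q + H ^ 4 * A) := by
  have hL0 : 0 < L := pos_of_mul_pos_left (zero_lt_one.trans_le hL) hH.le
  constructor
  · refine div_neg_of_neg_of_pos ?_ hD
    have h1 : H ^ 2 * K ≤ 0 := mul_nonpos_of_nonneg_of_nonpos (by positivity) hK
    -- If A = 0 then Q > 0 and the h'' term is strictly negative; otherwise the h' term is.
    rcases hA.eq_or_lt with rfl | hA'
    · have hQ' : 0 < Q := by
        rw [mul_zero, add_zero] at hD
        exact pos_of_mul_pos_right hD (by positivity)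
      have : 0 < H * H₂ * Q := by positivity
      linarith
    · have h2 : 0 < H ^ 2 * H₁ ^ 2 * A := by positivity
      have h3 : 0 ≤ H * H₂ * Q := by positivity
      linarith
  · rw [le_div_iff₀ hD]
    have h1 : -(|C| * A) ≤ K := by
      refine le_trans ?_ hCK
      rw [← neg_mul]
      exact mul_le_mul_of_nonneg_right (neg_abs_le C) hA
    have h2 : H₁ ^ 2 ≤ (L * H) ^ 2 := by gcongr
    -- The lower bound on H enters here: the factor (L H)² ≥ 1 turns H² into H⁴ in the base term.
    -- The three terms then cost L²|C|, L² and L times parts of the denominator.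
    have h3 : 1 ≤ (L * H) ^ 2 := one_le_pow₀ hL
    have h4 : H ^ 2 * (|C| * A) ≤ L ^ 2 * |C| * (H ^ 4 * A) := by
      calc H ^ 2 * (|C| * A) = H ^ 2 * (|C| * A) * 1 := (mul_one _).symm
        _ ≤ H ^ 2 * (|C| * A) * (L * H) ^ 2 := by gcongr
        _ = _ := by ring
    have h5 : H ^ 2 * H₁ ^ 2 * A ≤ L ^ 2 * (H ^ 4 * A) := by
      calc H ^ 2 * H₁ ^ 2 * A ≤ H ^ 2 * (L * H) ^ 2 * A := by gcongr
        _ = _ := by ring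
    have h6 : H * H₂ * Q ≤ L * (H ^ 2 * Q) := by
      calc H * H₂ * Q ≤ H * (L * H) * Q := by gcongr
        _ = _ := by ring
    have h7 : H ^ 2 * -(|C| * A) ≤ H ^ 2 * K := by gcongr
    have h8 : 0 ≤ L * (H ^ 4 * A) := by positivity
    have h9 : 0 ≤ L ^ 2 * (|C| + 1) * (H ^ 2 * Q) := by positivity
    linarith

/-! ### Sectional curvature of the warped product -/

section Warped

variable {E : Type*} [NormedAddCommGroup E] [NormedSpace ℝ E] [FiniteDimensional ℝ E]
  {H : Type*} [TopologicalSpace H] {I : ModelWithCorners ℝ E H} [I.Boundaryless]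
  {B : Type*} [TopologicalSpace B] [ChartedSpace H B] [IsManifold I ∞ B]

theorem sectionalCurvature_warpedProduct
    (gB : Bundle.ContMDiffRiemannianMetric I ∞ E (fun x : B => TangentSpace I x))
    (h : ℝ → ℝ) (hh : ContDiff ℝ ∞ h) (hpos : ∀ r, 0 < h r) (p : ℝ × B) (u v : ℝ × E) :
    let b := chartMetric gB p.2 (extChartAt I p.2 p.2)
    sectionalCurvature (warpedProduct gB h hh hpos) p u v =
      (h p.1 ^ 2 * b (coordCurvature (chartMetric gB p.2) (extChartAt I p.2 p.2) u.2 v.2 v.2) u.2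
        - h p.1 ^ 2 * deriv h p.1 ^ 2 * (b u.2 u.2 * b v.2 v.2 - b u.2 v.2 ^ 2)
        - h p.1 * deriv (deriv h) p.1 * b (v.1 • u.2 - u.1 • v.2) (v.1 • u.2 - u.1 • v.2)) /
      (h p.1 ^ 2 * b (v.1 • u.2 - u.1 • v.2) (v.1 • u.2 - u.1 • v.2)
        + h p.1 ^ 4 * (b u.2 u.2 * b v.2 v.2 - b u.2 v.2 ^ 2)) := by
  intro b
  have e := chartMetric_warpedProduct gB h hh hpos p
  rw [extChartAt_real_prod] at e
  refine (sectionalCurvature_eq (warpedProduct gB h hh hpos) p u v).trans ?_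
  rw [extChartAt_real_prod, coordCurvature_congr e, e.eq_of_nhds,
    warpedCoord_gram h (chartMetric_symm gB p.2)]
  rw [warpedCoord_coordCurvature hh (fun r => (hpos r).ne') (contDiffAt_chartMetric gB p.2)
    (chartMetric_symm gB p.2) (eventually_chartMetric_pos gB p.2)]

/-- Clearing the denominator lets the bounds include dependent pairs, for which both sides are 0. -/
theorem coordCurvature_bounds
    {gB : Bundle.ContMDiffRiemannianMetric I ∞ E (fun x : B => TangentSpace I x)} {C : ℝ}
    (hnonpos : SecNonpos gB) (hC : SecBoundedBelowBy gB C) (x : B) (u v : E) :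
    let b := chartMetric gB x (extChartAt I x x)
    let K := b (coordCurvature (chartMetric gB x) (extChartAt I x x) u v v) u
    0 ≤ b u u * b v v - b u v ^ 2 ∧ K ≤ 0 ∧ C * (b u u * b v v - b u v ^ 2) ≤ K := by
  intro b K
  have : CompleteSpace E := FiniteDimensional.complete ℝ E
  have hb := (eventually_chartMetric_pos gB x).self_of_nhds
  by_cases h : LinearIndependent ℝ ![u, v]
  · have hA : 0 < b u u * b v v - b u v ^ 2 := gram_pos (chartMetric_symm gB x _) hb h
    have h1 := (sectionalCurvature_eq gB x u v).symm.trans_le (hnonpos x u v h)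
    have h2 := (hC x u v h).trans_eq (sectionalCurvature_eq gB x u v)
    refine ⟨hA.le, ?_, (le_div_iff₀ hA).1 h2⟩
    exact ((div_le_iff₀ hA).1 h1).trans_eq (zero_mul _)
  · have hK : K = 0 := by
      simp only [K, coordCurvature_eq_zero_of_not_linearIndependent (contDiffAt_chartMetric gB x)
        (isInvertible_of_posDef hb) h, map_zero, zero_apply]
    rw [gram_eq_zero h, hK]
    simp

end Warped

end RiemannianGeometry

end

open RiemannianGeometry in
theorem theorem4p1 {E : Type*} [NormedAddCommGroup E] [NormedSpace ℝ E] [FiniteDimensional ℝ E]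
    {B : Type*} [TopologicalSpace B] [ChartedSpace E B] [IsManifold 𝓘(ℝ, E) ∞ B]
    (gB : Bundle.ContMDiffRiemannianMetric 𝓘(ℝ, E) ∞ E (fun x : B => TangentSpace 𝓘(ℝ, E) x))
    (hnonpos : RiemannianGeometry.SecNonpos gB)
    (hbdd : ∃ C : ℝ, RiemannianGeometry.SecBoundedBelowBy gB C) :
    ∃ (h : ℝ → ℝ) (hsmooth : ContDiff ℝ ∞ h) (hpos : ∀ r, 0 < h r),
      StrictMono h ∧ ConvexOn ℝ Set.univ h ∧ (∃ R : ℝ, ∀ r : ℝ, R ≤ r → h r = Real.exp r) ∧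
      RiemannianGeometry.SecNeg (RiemannianGeometry.warpedProduct gB h hsmooth hpos) ∧
      ∃ c : ℝ, RiemannianGeometry.SecBoundedBelowBy
        (RiemannianGeometry.warpedProduct gB h hsmooth hpos) c := by
  obtain ⟨C, hC⟩ := hbdd
  obtain ⟨h, L, hh, hpos, h1, h2, hR, hL, hL₁, hL₂⟩ := exists_warping_function
  have key : ∀ (p : ℝ × B) (u v : ℝ × E), LinearIndependent ℝ ![u, v] →
      sectionalCurvature (warpedProduct gB h hh hpos) p u v < 0 ∧
      -(L ^ 2 * (|C| + 1) + L) ≤ sectionalCurvature (warpedProduct gB h hh hpos) p u v := by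
    intro p u v hlin
    have hb := (eventually_chartMetric_pos gB p.2).self_of_nhds
    obtain ⟨hA, hK, hCK⟩ := coordCurvature_bounds hnonpos hC p.2 u.2 v.2
    rw [sectionalCurvature_warpedProduct gB h hh hpos p u v]
    refine warped_quotient_bounds hA ?_ (hpos _) (h1 _) (h2 _) hK hCK (hL _) (hL₁ _) (hL₂ _) ?_
    · by_cases h0 : v.1 • u.2 - u.1 • v.2 = 0
      · simp [h0]
      · exact (hb _ h0).le
    -- The denominator is the Gram determinant of u and v in the warped metric, positive since they
    -- are independent.
    · rw [← warpedCoord_gram h (chartMetric_symm gB p.2) (p.1, extChartAt 𝓘(ℝ, E) p.2 p.2) u v]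
      refine gram_pos (fun a b => ?_) (warpedCoord_posDef (hpos _).ne' hb) hlin
      rw [warpedCoord_apply, warpedCoord_apply, mul_comm a.1, chartMetric_symm]
  have hmono : StrictMono h := strictMono_of_deriv_pos h1
  refine ⟨h, hh, hpos, hmono, ?_, hR, fun p u v hlin => (key p u v hlin).1,
    _, fun p u v hlin => (key p u v hlin).2⟩
  refine convexOn_univ_of_deriv2_nonneg (hh.differentiable (by simp))
    ((contDiff_infty_iff_deriv.1 hh).2.differentiable (by simp)) fun r => ?_
  exact (h2 r).le
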